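/- For unit vectors $|\varphi\rangle,|\psi\rangle$ of $k$ qubits let $\mathrm{F}(|\varphi\rangle,|\psi\rangle)=|\langle\varphi|\psi\rangle|$ be their square root fidelity. A quantum query algorithm with $Q$ queries for pairs of $k$-qubit pure states has access to two unitary oracles $U_\varphi,U_\psi$ on $k$ qubits, which prepare $|\varphi\rangle=U_\varphi|0\rangle$ and $|\psi\rangle=U_\psi|0\rangle$. It acts on some finite number $n$ of qubits by $$\mathcal{A}=G_Q\,U_Q\cdots G_2\,U_2\,G_1\,U_1\,G_0,$$ where each $G_j$ is a unitary operator on the $n$ qubits that does not depend on the oracles, and each $U_j$ is one of $U_\varphi$, $U_\varphi^\dagger$, $U_\psi$, $U_\psi^\dagger$ applied to $k$ chosen qubits, or one of these operators controlled by one further qubit. A subset of the qubits of $\mathcal{A}|0\rangle$ is then measured in the computational basis, and a real number $\tilde x$ is computed from the outcome by a fixed function. The number $Q$ of queries, to both oracles together, is the query complexity of the algorithm. Theorem. There is an absolute constant $c>0$ such that the following holds for every $\varepsilon\in(0,1/4)$ and every number of qubits $k\ge 1$. If a quantum query algorithm estimates the square root fidelity of two $k$-qubit pure states to within additive error $\varepsilon$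 with probability at least $2/3$, that is, if for all $k$-qubit unitaries $U_\varphi,U_\psi$ $$\Pr\bigl[\,|\tilde x-\mathrm{F}(U_\varphi|0\rangle,U_\psi|0\rangle)|\le\varepsilon\,\bigr]\ \ge\ \tfrac23,$$ then its query complexity satisfies $Q\ge c/\varepsilon$; in short, $Q=\Omega(1/\varepsilon)$. -/

import Mathlib

open scoped Matrix

noncomputable section

/-- Labels of the computational basis of `n` qubits. -/
abbrev Bits (n : ℕ) : Type := Fin n → Bool

/-- The state space `(ℂ²)^{⊗ n}` of `n` qubits, with its Hilbert space norm. -/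
abbrev QState (n : ℕ) : Type := EuclideanSpace ℂ (Bits n)

/-- Unitary operators on `n` qubits, as matrices in the computational basis. -/
abbrev QUnitary (n : ℕ) : Type := Matrix.unitaryGroup (Bits n) ℂ

/-- The basis state `|0⟩ = |0…0⟩`. -/
def zeroKet (n : ℕ) : QState n := EuclideanSpace.single (fun _ => false) 1

/-- Apply the operator with matrix `M` to a state. -/
def applyOp {n : ℕ} (M : Matrix (Bits n) (Bits n) ℂ) (v : QState n) : QState n :=
  Matrix.toEuclideanLin M v

/-- The square root fidelity `F(|φ⟩, |ψ⟩) = |⟨φ|ψ⟩|` of two pure states. -/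
def sqrtFidelity {k : ℕ} (φ ψ : QState k) : ℝ := ‖inner ℂ φ ψ‖

/-- The pure state `U|0⟩` prepared by `U`. -/
def preparedState {k : ℕ} (U : QUnitary k) : QState k :=
  applyOp (U : Matrix (Bits k) (Bits k) ℂ) (zeroKet k)

/-- The `k`-qubit operator `M` acting on the wires `e 0, …, e (k - 1)` of an `n`-qubit register,
tensored with the identity on the remaining wires. -/
def onWires {k n : ℕ} (e : Fin k ↪ Fin n) (M : Matrix (Bits k) (Bits k) ℂ) :
    Matrix (Bits n) (Bits n) ℂ :=
  Matrix.of fun x y =>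
    if ∀ i, i ∉ Set.range e → x i = y i then M (fun j => x (e j)) (fun j => y (e j)) else 0

/-- The controlled version of an operator `M` that acts as the identity on wire `c`: apply `M` if
qubit `c` is `1`, and nothing if it is `0`. -/
def controlledOp {n : ℕ} (c : Fin n) (M : Matrix (Bits n) (Bits n) ℂ) :
    Matrix (Bits n) (Bits n) ℂ :=
  Matrix.of fun x y => if x c = true then M x y else (1 : Matrix (Bits n) (Bits n) ℂ) x y

/-- The two state-preparation oracles that an algorithm may call. -/
inductive OracleName : Type where
  | phi : OracleName
  | psi : OracleName

/-- One query in an `n`-qubit circuit to one of the two `k`-qubit oracles or to its inverse, on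
chosen wires, possibly controlled by one further qubit. -/
structure OracleQuery (k n : ℕ) : Type where
  /-- which of the two oracles is called -/
  name : OracleName
  /-- whether the inverse of the oracle is called -/
  inverse : Bool
  /-- the wires on which the oracle acts -/
  target : Fin k ↪ Fin n
  /-- the control qubit, if the query is controlled -/
  control : Option (Fin n)
  /-- the control qubit is not among the wires on which the oracle acts -/
  control_notMem : ∀ c, control = some c → c ∉ Set.range target

/-- The operator on the `n`-qubit register carried out by a query, for given oracles. -/
def OracleQuery.op {k n : ℕ} (q : OracleQuery k n) (Uphi Upsi : QUnitary k) :
    Matrix (Bits n) (Bits n) ℂ :=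
  let U : QUnitary k := match q.name with
    | .phi => Uphi
    | .psi => Upsi
  let V : Matrix (Bits k) (Bits k) ℂ := if q.inverse = true then (U : Matrix _ _ ℂ)ᴴ else U
  match q.control with
    | none => onWires q.target V
    | some c => controlledOp c (onWires q.target V)

/-- A quantum query algorithm on `n` qubits with access to two `k`-qubit oracles: the circuit
`G_Q U_Q ⋯ G_1 U_1 G_0`, in which the `U_j` are queries and the gates `G_j` are unitaries that do
not depend on the oracles (any unitary on the register, so in particular any circuit of one- and
two-qubit gates), followed by a measurement of a subset of the qubits in the computational basis;
the outcome is turned into a real number by a classical function. -/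
structure QueryAlgorithm (k n : ℕ) : Type where
  /-- the gate `G_0` -/
  initialGate : QUnitary n
  /-- the pairs `(U_j, G_j)` for `j = 1, …, Q`, in the order in which they are applied -/
  steps : List (OracleQuery k n × QUnitary n)
  /-- the qubits that are measured at the end -/
  measured : Finset (Fin n)
  /-- the number returned on each measurement outcome -/
  output : (measured → Bool) → ℝ

namespace QueryAlgorithm

variable {k n : ℕ}

/-- The number `Q` of queries made, to both oracles together. -/
def queryComplexity (A : QueryAlgorithm k n) : ℕ := A.steps.length

/-- The state `G_Q U_Q ⋯ G_1 U_1 G_0 |0⟩` before the measurement. -/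
def finalState (A : QueryAlgorithm k n) (Uphi Upsi : QUnitary k) : QState n :=
  A.steps.foldl
    (fun v s => applyOp (s.2 : Matrix (Bits n) (Bits n) ℂ) (applyOp (s.1.op Uphi Upsi) v))
    (applyOp (A.initialGate : Matrix (Bits n) (Bits n) ℂ) (zeroKet n))

/-- The projector `P_m` onto the span of the basis states whose measured qubits read `m`. -/
def projector (A : QueryAlgorithm k n) (m : A.measured → Bool) : Matrix (Bits n) (Bits n) ℂ :=
  Matrix.diagonal fun x => if ∀ i : A.measured, x i = m i then 1 else 0

/-- The probability `‖P_m 𝒜|0⟩‖²` of the measurement outcome `m`. -/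
def outcomeProb (A : QueryAlgorithm k n) (Uphi Upsi : QUnitary k) (m : A.measured → Bool) : ℝ :=
  ‖applyOp (A.projector m) (A.finalState Uphi Upsi)‖ ^ 2

open Classical in
/-- For all oracles `U_φ`, `U_ψ`, the output is with probability at least `2/3` within additive
error `ε` of the square root fidelity of the prepared states `U_φ|0⟩` and `U_ψ|0⟩`. -/
def EstimatesSqrtFidelity (A : QueryAlgorithm k n) (ε : ℝ) : Prop :=
  ∀ Uphi Upsi : QUnitary k,
    2 / 3 ≤ ∑ m : A.measured → Bool,
      if |A.output m - sqrtFidelity (preparedState Uphi) (preparedState Upsi)| ≤ ε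
        then A.outcomeProb Uphi Upsi m else 0

end QueryAlgorithm

end

/-! The bound comes from a hybrid argument on two instances that are hard to tell apart. Take `U_ψ =
1` and let `U_φ` rotate a single qubit, with cosine `3ε` in one instance and `0` in the other. The
fidelities are `3ε` and `0`, more than `2ε` apart, so the events "estimate correct" are disjoint and
the final states must be at least `1/6` apart (`EstimatesSqrtFidelity.norm_finalState_sub_ge`). The
two rotations differ by at most `6ε` in operator norm, and so does each query, inverted or
controlled (`OracleQuery.norm_op_sub_le`). As all other gates are shared, `Q` queries separate the
states by at most `6εQ` (`norm_finalState_sub_le`). Hence `6εQ ≥ 1/6`. -/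

open scoped Kronecker

/-! ### Norms of operators on selected wires, controlled operators, coordinate projections -/

section Operators

variable {k n : ℕ}

theorem applyOp_apply (M : Matrix (Bits n) (Bits n) ℂ) (v : QState n) (x : Bits n) :
    applyOp M v x = ∑ y, M x y * v y := rfl

theorem applyOp_sub (M : Matrix (Bits n) (Bits n) ℂ) (v w : QState n) :
    applyOp M (v - w) = applyOp M v - applyOp M w := map_sub _ _ _

theorem sub_applyOp (M N : Matrix (Bits n) (Bits n) ℂ) (v : QState n) :
    applyOp (M - N) v = applyOp M v - applyOp N v := by
  simp [applyOp]

/-- If `Mᴴ M = d² · 1` then `M` scales all norms by `|d|`. -/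
theorem norm_sq_applyOp_of_conjTranspose_mul_self {M : Matrix (Bits n) (Bits n) ℂ} {d : ℝ}
    (h : Mᴴ * M = ((d ^ 2 : ℝ) : ℂ) • 1) (v : QState n) :
    ‖applyOp M v‖ ^ 2 = d ^ 2 * ‖v‖ ^ 2 := by
  have h1 : inner ℂ (applyOp M v) (applyOp M v) = inner ℂ v (applyOp (Mᴴ * M) v) := by
    have e : applyOp (Mᴴ * M) v = Matrix.toEuclideanLin Mᴴ (applyOp M v) := by
      apply PiLp.ext
      intro x
      exact congrFun (Matrix.mulVec_mulVec v.ofLp Mᴴ M).symm x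
    rw [e, Matrix.toEuclideanLin_conjTranspose_eq_adjoint, LinearMap.adjoint_inner_right]
    rfl
  have h2 : applyOp (Mᴴ * M) v = ((d ^ 2 : ℝ) : ℂ) • v := by
    rw [h]
    simp [applyOp]
  rw [h2, inner_smul_right, inner_self_eq_norm_sq_to_K, inner_self_eq_norm_sq_to_K] at h1
  have h3 : ((‖applyOp M v‖ : ℝ) : ℂ) ^ 2 = ((d ^ 2 : ℝ) : ℂ) * ((‖v‖ : ℝ) : ℂ) ^ 2 := h1
  exact_mod_cast h3

theorem norm_applyOp_of_conjTranspose_mul_self {M : Matrix (Bits n) (Bits n) ℂ} {d : ℝ}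
    (hd : 0 ≤ d) (h : Mᴴ * M = ((d ^ 2 : ℝ) : ℂ) • 1) (v : QState n) :
    ‖applyOp M v‖ = d * ‖v‖ := by
  have := norm_sq_applyOp_of_conjTranspose_mul_self h v
  rw [← mul_pow] at this
  exact (pow_left_inj₀ (norm_nonneg _) (by positivity) two_ne_zero).1 this

theorem norm_applyOp_unitary (G : QUnitary n) (v : QState n) :
    ‖applyOp (G : Matrix (Bits n) (Bits n) ℂ) v‖ = ‖v‖ := by
  have h : (G : Matrix (Bits n) (Bits n) ℂ)ᴴ * G = (((1 : ℝ) ^ 2 : ℝ) : ℂ) • 1 := by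
    rw [one_pow, Complex.ofReal_one, one_smul]
    exact Matrix.mem_unitaryGroup_iff'.1 G.2
  simpa using norm_applyOp_of_conjTranspose_mul_self zero_le_one h v

theorem norm_zeroKet : ‖zeroKet n‖ = 1 := by simp [zeroKet]

/-- Splitting a basis label into its part on the wires `e` and its part on the other wires. -/
noncomputable def splitBits (e : Fin k ↪ Fin n) :
    Bits n ≃ Bits k × ({i // ¬ i ∈ Set.range e} → Bool) := by
  classical
  exact (Equiv.piEquivPiSubtypeProd (fun i => i ∈ Set.range e) (fun _ => Bool)).trans
    (Equiv.prodCongr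
      (Equiv.arrowCongr (Equiv.ofInjective e e.injective).symm (Equiv.refl Bool))
      (Equiv.refl _))

/-- After regrouping the wires the operator is `M ⊗ 1`, so products, adjoints and scalars pass
through `onWires`. -/
theorem onWires_eq_kronecker (e : Fin k ↪ Fin n) (M : Matrix (Bits k) (Bits k) ℂ) :
    onWires e M = (M ⊗ₖ (1 : Matrix ({i // ¬ i ∈ Set.range e} → Bool) _ ℂ)).submatrix
      (splitBits e) (splitBits e) := by
  ext x y
  have h : (splitBits e x).2 = (splitBits e y).2 ↔ ∀ i, i ∉ Set.range e → x i = y i :=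
    ⟨fun h i hi => congrFun h ⟨i, hi⟩, fun h => funext fun i => h i.1 i.2⟩
  simp only [onWires, Matrix.of_apply, Matrix.submatrix_apply, Matrix.kroneckerMap_apply,
    Matrix.one_apply, h, mul_ite, mul_one, mul_zero]
  rfl

theorem onWires_mul (e : Fin k ↪ Fin n) (M N : Matrix (Bits k) (Bits k) ℂ) :
    onWires e (M * N) = onWires e M * onWires e N := by
  simp only [onWires_eq_kronecker, Matrix.submatrix_mul_equiv, ← Matrix.mul_kronecker_mul, mul_one]

theorem onWires_conjTranspose (e : Fin k ↪ Fin n) (M : Matrix (Bits k) (Bits k) ℂ) :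
    onWires e Mᴴ = (onWires e M)ᴴ := by
  simp only [onWires_eq_kronecker, Matrix.conjTranspose_submatrix, Matrix.conjTranspose_kronecker,
    Matrix.conjTranspose_one]

theorem onWires_smul_one (e : Fin k ↪ Fin n) (a : ℂ) :
    onWires e (a • (1 : Matrix (Bits k) (Bits k) ℂ)) = a • 1 := by
  simp only [onWires_eq_kronecker, Matrix.smul_kronecker, Matrix.one_kronecker_one,
    Matrix.submatrix_smul, Matrix.submatrix_one_equiv, Pi.smul_apply]

theorem onWires_sub (e : Fin k ↪ Fin n) (M N : Matrix (Bits k) (Bits k) ℂ) :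
    onWires e (M - N) = onWires e M - onWires e N := by
  ext x y
  simp only [onWires, Matrix.of_apply, Matrix.sub_apply]
  split_ifs <;> simp

theorem onWires_conjTranspose_mul_self (e : Fin k ↪ Fin n) {M : Matrix (Bits k) (Bits k) ℂ}
    {a : ℂ} (h : Mᴴ * M = a • 1) : (onWires e M)ᴴ * onWires e M = a • 1 := by
  rw [← onWires_conjTranspose, ← onWires_mul, h, onWires_smul_one]

theorem norm_onWires {e : Fin k ↪ Fin n} {M : Matrix (Bits k) (Bits k) ℂ} {d : ℝ} (hd : 0 ≤ d)
    (h : Mᴴ * M = ((d ^ 2 : ℝ) : ℂ) • 1) (v : QState n) :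
    ‖applyOp (onWires e M) v‖ = d * ‖v‖ :=
  norm_applyOp_of_conjTranspose_mul_self hd (onWires_conjTranspose_mul_self e h) v

/-- Rows with control bit `0` cancel in the difference; the other rows are those of `M - N`. -/
theorem norm_applyOp_controlledOp_sub_le (c : Fin n) (M N : Matrix (Bits n) (Bits n) ℂ)
    (v : QState n) :
    ‖applyOp (controlledOp c M - controlledOp c N) v‖ ≤ ‖applyOp (M - N) v‖ := by
  rw [← sq_le_sq₀ (norm_nonneg _) (norm_nonneg _), EuclideanSpace.norm_sq_eq,
    EuclideanSpace.norm_sq_eq]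
  refine Finset.sum_le_sum fun x _ => ?_
  by_cases hx : x c = true
  · simp [applyOp_apply, controlledOp, hx]
  · simp [applyOp_apply, controlledOp, hx]

/-- The projection of a state to the basis labels satisfying `p`. -/
def restrictState (p : Bits n → Prop) [DecidablePred p] (v : QState n) : QState n :=
  WithLp.toLp 2 fun x => if p x then v x else 0

theorem restrictState_sub (p : Bits n → Prop) [DecidablePred p] (v w : QState n) :
    restrictState p (v - w) = restrictState p v - restrictState p w := by
  apply PiLp.ext
  intro x
  by_cases h : p x <;> simp [restrictState, h]

theorem norm_sq_restrictState (p : Bits n → Prop) [DecidablePred p] (v : QState n) :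
    ‖restrictState p v‖ ^ 2 = ∑ x, if p x then ‖v x‖ ^ 2 else 0 := by
  rw [EuclideanSpace.norm_sq_eq]
  refine Finset.sum_congr rfl fun x _ => ?_
  by_cases h : p x <;> simp [restrictState, h]

theorem norm_sq_restrictState_add_le (p q : Bits n → Prop) [DecidablePred p] [DecidablePred q]
    (hpq : ∀ x, p x → ¬ q x) (v : QState n) :
    ‖restrictState p v‖ ^ 2 + ‖restrictState q v‖ ^ 2 ≤ ‖v‖ ^ 2 := by
  rw [norm_sq_restrictState, norm_sq_restrictState, EuclideanSpace.norm_sq_eq,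
    ← Finset.sum_add_distrib]
  refine Finset.sum_le_sum fun x _ => ?_
  by_cases hp : p x
  · simp [hp, hpq x hp]
  · by_cases hq : q x <;> simp [hp, hq]

theorem norm_restrictState_le (p : Bits n → Prop) [DecidablePred p] (v : QState n) :
    ‖restrictState p v‖ ≤ ‖v‖ := by
  have := norm_sq_restrictState_add_le p (fun _ => False) (by simp) v
  exact (sq_le_sq₀ (norm_nonneg _) (norm_nonneg _)).1 (by nlinarith [sq_nonneg ‖restrictState (fun _ : Bits n => False) v‖])

/-- The operator preserves the control bit, so it acts isometrically on the control-`1` half of the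
state and trivially on the other half. -/
theorem norm_controlledOp_onWires_le {e : Fin k ↪ Fin n} {c : Fin n} (hc : c ∉ Set.range e)
    {M : Matrix (Bits k) (Bits k) ℂ} (h : Mᴴ * M = 1) (v : QState n) :
    ‖applyOp (controlledOp c (onWires e M)) v‖ ≤ ‖v‖ := by
  set w := restrictState (fun x => x c = true) v with hw
  have h1 : ‖applyOp (onWires e M) w‖ = ‖w‖ := by
    simpa using norm_onWires (e := e) zero_le_one (by simpa using h) w
  have h2 : ∀ x, x c = true →
      applyOp (controlledOp c (onWires e M)) v x = applyOp (onWires e M) w x := by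
    intro x hx
    rw [applyOp_apply, applyOp_apply]
    refine Finset.sum_congr rfl fun y _ => ?_
    simp only [controlledOp, Matrix.of_apply, hx, if_true, hw, restrictState]
    by_cases hy : y c = true
    · simp [hy]
    -- Entries between labels with different control bits vanish, since `c` is not a target wire.
    · have : ¬ ∀ i, i ∉ Set.range e → x i = y i := fun H => hy ((H c hc) ▸ hx)
      simp only [onWires, Matrix.of_apply, if_neg this, zero_mul]
  have h3 : ∀ x, ¬ x c = true → applyOp (controlledOp c (onWires e M)) v x = v x := by
    intro x hx
    simp [applyOp_apply, controlledOp, hx, Matrix.one_apply]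
  have h4 : ‖applyOp (controlledOp c (onWires e M)) v‖ ^ 2
      ≤ ‖applyOp (onWires e M) w‖ ^ 2 + ‖restrictState (fun x => ¬ x c = true) v‖ ^ 2 := by
    rw [norm_sq_restrictState, EuclideanSpace.norm_sq_eq, EuclideanSpace.norm_sq_eq,
      ← Finset.sum_add_distrib]
    refine Finset.sum_le_sum fun x _ => ?_
    by_cases hx : x c = true
    · rw [h2 x hx]; simp [hx]
    · rw [h3 x hx, if_pos hx]
      nlinarith [sq_nonneg ‖applyOp (onWires e M) w x‖]
  rw [h1] at h4
  exact (sq_le_sq₀ (norm_nonneg _) (norm_nonneg _)).1 (h4.trans (norm_sq_restrictState_add_le _ _ (fun x hx => not_not.2 hx) v))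

end Operators

/-! ### Single queries: contraction and dependence on the oracle -/

section Queries

variable {k n : ℕ}

theorem OracleQuery.norm_op_le (q : OracleQuery k n) (U V : QUnitary k) (v : QState n) :
    ‖applyOp (q.op U V) v‖ ≤ ‖v‖ := by
  have key : ∀ W : Matrix (Bits k) (Bits k) ℂ, Wᴴ * W = 1 →
      ‖applyOp (match q.control with
        | none => onWires q.target W
        | some c => controlledOp c (onWires q.target W)) v‖ ≤ ‖v‖ := by
    intro W hW
    split
    · exact (by simpa using norm_onWires (e := q.target) zero_le_one (by simpa using hW) v :
        ‖applyOp (onWires q.target W) v‖ = ‖v‖).le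
    · rename_i c hc
      exact norm_controlledOp_onWires_le (q.control_notMem c hc) hW v
  refine key _ ?_
  generalize (match q.name with
    | .phi => U
    | .psi => V : QUnitary k) = W
  split_ifs
  · rw [Matrix.conjTranspose_conjTranspose]
    exact Matrix.mem_unitaryGroup_iff.1 W.2
  · exact Matrix.mem_unitaryGroup_iff'.1 W.2

/-- Two oracles whose difference is `d` times a unitary give queries at distance at most `d`. -/
theorem OracleQuery.norm_op_sub_le (q : OracleQuery k n) (U U' V : QUnitary k) {d : ℝ}
    (hd : 0 ≤ d)
    (h : ((U : Matrix (Bits k) (Bits k) ℂ) - (U' : Matrix (Bits k) (Bits k) ℂ))ᴴ *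
        ((U : Matrix (Bits k) (Bits k) ℂ) - (U' : Matrix (Bits k) (Bits k) ℂ))
      = ((d ^ 2 : ℝ) : ℂ) • 1)
    (h' : ((U : Matrix (Bits k) (Bits k) ℂ) - (U' : Matrix (Bits k) (Bits k) ℂ)) *
        ((U : Matrix (Bits k) (Bits k) ℂ) - (U' : Matrix (Bits k) (Bits k) ℂ))ᴴ
      = ((d ^ 2 : ℝ) : ℂ) • 1) (v : QState n) :
    ‖applyOp (q.op U V) v - applyOp (q.op U' V) v‖ ≤ d * ‖v‖ := by
  have key : ∀ W W' : Matrix (Bits k) (Bits k) ℂ,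
      (W - W')ᴴ * (W - W') = ((d ^ 2 : ℝ) : ℂ) • 1 →
      ‖applyOp (match q.control with
        | none => onWires q.target W
        | some c => controlledOp c (onWires q.target W)) v -
       applyOp (match q.control with
        | none => onWires q.target W'
        | some c => controlledOp c (onWires q.target W')) v‖ ≤ d * ‖v‖ := by
    intro W W' hW
    have hn := norm_onWires (e := q.target) hd hW v
    rw [onWires_sub] at hn
    cases q.control with
    | none => rw [← hn, sub_applyOp]
    | some c =>
      rw [← hn, ← sub_applyOp]
      exact norm_applyOp_controlledOp_sub_le _ _ _ _
  obtain ⟨name, inverse, target, control, hcontrol⟩ := q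
  cases name with
  | psi =>
    -- Both sides call the same oracle `V`.
    exact (norm_sub_eq_zero_iff.2 rfl).trans_le (by positivity)
  | phi =>
    refine key _ _ ?_
    cases inverse
    · simpa using h
    -- For an inverse query the difference is the adjoint, which swaps the roles of `h` and `h'`.
    · simpa using h'

end Queries

/-! ### Hybrid argument and distinguishability of final states -/

namespace QueryAlgorithm

variable {k n : ℕ}

theorem norm_finalState_le (A : QueryAlgorithm k n) (U V : QUnitary k) :
    ‖A.finalState U V‖ ≤ 1 := by
  suffices H : ∀ (l : List (OracleQuery k n × QUnitary n)) (v : QState n), ‖v‖ ≤ 1 →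
      ‖l.foldl (fun v s => applyOp (s.2 : Matrix (Bits n) (Bits n) ℂ)
        (applyOp (s.1.op U V) v)) v‖ ≤ 1 by
    exact H _ _ (by rw [norm_applyOp_unitary, norm_zeroKet])
  intro l
  induction l with
  | nil => exact fun v hv => hv
  | cons s l ih =>
    intro v hv
    refine ih _ ?_
    rw [norm_applyOp_unitary]
    exact (s.1.norm_op_le U V v).trans hv

/-- The hybrid argument: each query moves the state by at most `d`. -/
theorem norm_finalState_sub_le (A : QueryAlgorithm k n) (U U' V : QUnitary k) {d : ℝ}
    (hd : ∀ (q : OracleQuery k n) (v : QState n),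
      ‖applyOp (q.op U V) v - applyOp (q.op U' V) v‖ ≤ d * ‖v‖) (hd0 : 0 ≤ d) :
    ‖A.finalState U V - A.finalState U' V‖ ≤ A.queryComplexity * d := by
  -- Distinct starting states `v`, `w` are needed for the induction, because the two runs diverge
  -- after one query.
  suffices H : ∀ (l : List (OracleQuery k n × QUnitary n)) (v w : QState n), ‖v‖ ≤ 1 →
      ‖l.foldl (fun v s => applyOp (s.2 : Matrix (Bits n) (Bits n) ℂ)
          (applyOp (s.1.op U V) v)) v -
        l.foldl (fun v s => applyOp (s.2 : Matrix (Bits n) (Bits n) ℂ)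
          (applyOp (s.1.op U' V) v)) w‖ ≤ ‖v - w‖ + l.length * d by
    have := H A.steps (applyOp (A.initialGate : Matrix (Bits n) (Bits n) ℂ) (zeroKet n))
      (applyOp (A.initialGate : Matrix (Bits n) (Bits n) ℂ) (zeroKet n))
      (by rw [norm_applyOp_unitary, norm_zeroKet])
    rwa [sub_self, norm_zero, zero_add] at this
  intro l
  induction l with
  | nil => intro v w _; simp
  | cons s l ih =>
    intro v w hv
    refine (ih _ _ ?_).trans ?_
    · rw [norm_applyOp_unitary]
      exact (s.1.norm_op_le U V v).trans hv
    · rw [← applyOp_sub, norm_applyOp_unitary s.2, List.length_cons]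
      -- Change the oracle on `v` at cost `d`, then the state under a fixed contraction.
      have e : applyOp (s.1.op U V) v - applyOp (s.1.op U' V) w =
          (applyOp (s.1.op U V) v - applyOp (s.1.op U' V) v) +
            applyOp (s.1.op U' V) (v - w) := by
        rw [applyOp_sub]; abel
      have h1 := norm_add_le (applyOp (s.1.op U V) v - applyOp (s.1.op U' V) v)
        (applyOp (s.1.op U' V) (v - w))
      rw [← e] at h1
      have h2 := s.1.norm_op_le U' V (v - w)
      have h3 := (hd s.1 v).trans (mul_le_of_le_one_right hd0 hv)
      push_cast
      linarith

open Classical in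
/-- The probability of an event is the squared norm of a projection of the final state. -/
theorem sum_outcomeProb_eq (A : QueryAlgorithm k n) (U V : QUnitary k)
    (p : (A.measured → Bool) → Prop) :
    ∑ m, (if p m then A.outcomeProb U V m else 0) =
      ‖restrictState (fun x => p fun i => x i) (A.finalState U V)‖ ^ 2 := by
  have h : ∀ m, A.outcomeProb U V m =
      ∑ x : Bits n, if (fun i : A.measured => x i) = m then ‖A.finalState U V x‖ ^ 2 else 0 := by
    intro m
    rw [outcomeProb, EuclideanSpace.norm_sq_eq]
    refine Finset.sum_congr rfl fun x _ => ?_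
    have e : applyOp (A.projector m) (A.finalState U V) x =
        (if ∀ i : A.measured, x i = m i then 1 else 0) * A.finalState U V x :=
      Matrix.mulVec_diagonal _ _ x
    rw [e]
    by_cases hx : ∀ i : A.measured, x i = m i
    · rw [if_pos hx, if_pos (funext hx), one_mul]
    · rw [if_neg hx, if_neg fun H => hx (congrFun H)]
      simp
  rw [norm_sq_restrictState]
  simp only [h, ← Finset.sum_filter]
  -- Each basis label is compatible with exactly one outcome, its restriction to the measured
  -- qubits.
  rw [Finset.sum_comm' (t' := Finset.univ.filter fun x : Bits n => p fun i => x i)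
    (s' := fun x => {fun i : A.measured => x i})]
  · simp
  · intro m x
    simp only [Finset.mem_filter, Finset.mem_univ, true_and, Finset.mem_singleton]
    constructor
    · rintro ⟨h1, rfl⟩
      exact ⟨rfl, h1⟩
    · rintro ⟨rfl, h1⟩
      exact ⟨h1, rfl⟩

open Classical in
/-- Distinguishing two oracles whose fidelities with `V|0⟩` are more than `2 ε` apart forces the
final states to be far from each other. -/
theorem EstimatesSqrtFidelity.norm_finalState_sub_ge {A : QueryAlgorithm k n} {ε : ℝ}
    (hA : A.EstimatesSqrtFidelity ε) (U U' V : QUnitary k)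
    (hU : sqrtFidelity (preparedState U') (preparedState V) + 2 * ε <
      sqrtFidelity (preparedState U) (preparedState V)) :
    1 / 6 ≤ ‖A.finalState U V - A.finalState U' V‖ := by
  have h1 := hA U V
  have h2 := hA U' V
  rw [sum_outcomeProb_eq A _ _
    (fun m => |A.output m - sqrtFidelity (preparedState U) (preparedState V)| ≤ ε)] at h1
  rw [sum_outcomeProb_eq A _ _
    (fun m => |A.output m - sqrtFidelity (preparedState U') (preparedState V)| ≤ ε)] at h2
  set p : Bits n → Prop := fun x => |A.output (fun i => x i) -
    sqrtFidelity (preparedState U) (preparedState V)| ≤ ε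
  set q : Bits n → Prop := fun x => |A.output (fun i => x i) -
    sqrtFidelity (preparedState U') (preparedState V)| ≤ ε
  have hpq : ∀ x, p x → ¬ q x := by
    intro x hp hq
    have hp' := abs_le.1 hp
    have hq' := abs_le.1 hq
    linarith [hp'.1, hq'.2]
  set v := A.finalState U V
  set w := A.finalState U' V
  have hv : ‖v‖ ≤ 1 := A.norm_finalState_le U V
  have hw : ‖w‖ ≤ 1 := A.norm_finalState_le U' V
  have h3 := norm_sq_restrictState_add_le p q hpq w
  have h4 : ‖restrictState p v‖ - ‖restrictState p w‖ ≤ ‖v - w‖ := by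
    refine (norm_sub_norm_le _ _).trans ?_
    rw [← restrictState_sub]
    exact norm_restrictState_le _ _
  have h5 := (norm_restrictState_le p v).trans hv
  have h6 := (norm_restrictState_le p w).trans hw
  have h7 := norm_nonneg (restrictState p v)
  have h8 := norm_nonneg (restrictState p w)
  have h9 : ‖w‖ ^ 2 ≤ 1 := pow_le_one₀ (norm_nonneg _) hw
  -- The event `p` has probability at least `2/3` on `v` and at most `1/3` on `w`. Factoring the
  -- difference of squares gives `1/3 ≤ 2‖v - w‖`.
  have h10 := mul_le_mul_of_nonneg_right h4 (add_nonneg h7 h8)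
  have h11 : ‖v - w‖ * (‖restrictState p v‖ + ‖restrictState p w‖) ≤ ‖v - w‖ * 2 :=
    mul_le_mul_of_nonneg_left (by linarith) (norm_nonneg _)
  nlinarith

end QueryAlgorithm

/-! ### The hard instances: one-qubit rotations -/

section Rotations

variable {k : ℕ}

/-- The real one-qubit matrix with rows `(a, -b)` and `(b, a)`. -/
def planeMatrix (a b : ℝ) : Matrix (Bits 1) (Bits 1) ℂ :=
  Matrix.of fun x y => if x 0 = y 0 then (a : ℂ) else if x 0 = true then (b : ℂ) else -b

theorem planeMatrix_sub (a b a' b' : ℝ) :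
    planeMatrix a b - planeMatrix a' b' = planeMatrix (a - a') (b - b') := by
  ext x y
  simp only [planeMatrix, Matrix.sub_apply, Matrix.of_apply]
  split_ifs <;> push_cast <;> ring

theorem planeMatrix_conjTranspose (a b : ℝ) : (planeMatrix a b)ᴴ = planeMatrix a (-b) := by
  ext x y
  simp only [planeMatrix, Matrix.conjTranspose_apply, Matrix.of_apply]
  cases hx : x 0 <;> cases hy : y 0 <;> simp

/-- Without the normalization `a² + b² = 1` this also covers differences of rotations, which are
therefore multiples of unitaries. -/
theorem planeMatrix_conjTranspose_mul_self (a b : ℝ) :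
    (planeMatrix a b)ᴴ * planeMatrix a b = ((a ^ 2 + b ^ 2 : ℝ) : ℂ) • 1 := by
  rw [planeMatrix_conjTranspose]
  ext x y
  have hxy : x = y ↔ x 0 = y 0 :=
    ⟨fun h => congrFun h 0, fun h => funext fun i => by rwa [Subsingleton.elim i 0]⟩
  rw [Matrix.mul_apply, ← (Equiv.funUnique (Fin 1) Bool).symm.sum_comp]
  simp only [planeMatrix, Matrix.of_apply, Matrix.smul_apply, Matrix.one_apply, hxy,
    Fintype.sum_bool]
  cases hx : x 0 <;> cases hy : y 0 <;> simp <;> ring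

theorem planeMatrix_mul_conjTranspose_self (a b : ℝ) :
    planeMatrix a b * (planeMatrix a b)ᴴ = ((a ^ 2 + b ^ 2 : ℝ) : ℂ) • 1 := by
  have h := planeMatrix_conjTranspose_mul_self a (-b)
  rw [planeMatrix_conjTranspose, neg_neg, neg_sq] at h
  rw [planeMatrix_conjTranspose, h]

/-- The embedding of a single wire as the wire `i`. -/
def singleWire (i : Fin k) : Fin 1 ↪ Fin k := ⟨fun _ => i, fun _ _ _ => Subsingleton.elim _ _⟩

/-- The rotation with cosine `a` and sine `b`, on the wire `i` of a `k`-qubit register. -/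
def wireRotation (i : Fin k) (a b : ℝ) (h : a ^ 2 + b ^ 2 = 1) : QUnitary k :=
  ⟨onWires (singleWire i) (planeMatrix a b), by
    rw [Matrix.mem_unitaryGroup_iff', Matrix.star_eq_conjTranspose,
      onWires_conjTranspose_mul_self _ (planeMatrix_conjTranspose_mul_self a b), h]
    simp⟩

theorem sqrtFidelity_wireRotation (i : Fin k) (a b : ℝ) (h : a ^ 2 + b ^ 2 = 1) :
    sqrtFidelity (preparedState (wireRotation i a b h)) (preparedState 1) = |a| := by
  have h1 : preparedState (1 : QUnitary k) = zeroKet k := by simp [preparedState, applyOp]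
  rw [sqrtFidelity, h1, zeroKet, EuclideanSpace.inner_single_right, preparedState, applyOp_apply]
  simp [zeroKet, wireRotation, onWires, planeMatrix]

theorem wireRotation_sub (i : Fin k) (a b a' b' : ℝ) (h : a ^ 2 + b ^ 2 = 1)
    (h' : a' ^ 2 + b' ^ 2 = 1) :
    (wireRotation i a b h : Matrix (Bits k) (Bits k) ℂ) - (wireRotation i a' b' h' : Matrix (Bits k) (Bits k) ℂ) =
      onWires (singleWire i) (planeMatrix (a - a') (b - b')) := by
  rw [← planeMatrix_sub, onWires_sub]
  rfl

theorem OracleQuery.norm_op_wireRotation_sub_le {n : ℕ} (q : OracleQuery k n) (V : QUnitary k)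
    (i : Fin k) (a b a' b' : ℝ) (h : a ^ 2 + b ^ 2 = 1) (h' : a' ^ 2 + b' ^ 2 = 1)
    (v : QState n) :
    ‖applyOp (q.op (wireRotation i a b h) V) v - applyOp (q.op (wireRotation i a' b' h') V) v‖ ≤
      √((a - a') ^ 2 + (b - b') ^ 2) * ‖v‖ := by
  refine q.norm_op_sub_le _ _ V (Real.sqrt_nonneg _) ?_ ?_ v
  · rw [wireRotation_sub, Real.sq_sqrt (by positivity)]
    exact onWires_conjTranspose_mul_self _ (planeMatrix_conjTranspose_mul_self _ _)
  · rw [wireRotation_sub, Real.sq_sqrt (by positivity), ← onWires_conjTranspose, ← onWires_mul,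
      planeMatrix_mul_conjTranspose_self, onWires_smul_one]

end Rotations

theorem theorem5p3 :
    ∃ c : ℝ, 0 < c ∧
      ∀ ε : ℝ, 0 < ε → ε < 1 / 4 →
        ∀ k : ℕ, 1 ≤ k → ∀ (n : ℕ) (A : QueryAlgorithm k n),
          A.EstimatesSqrtFidelity ε → c / ε ≤ (A.queryComplexity : ℝ) := by
  -- `1/36` is the required separation `1/6` divided by the factor `6` in the cost `6ε` per query.
  refine ⟨1 / 36, by norm_num, fun ε hε hε4 k hk n A hA => ?_⟩
  have hs : 0 ≤ 1 - (3 * ε) ^ 2 := by nlinarith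
  have hb : (3 * ε) ^ 2 + √(1 - (3 * ε) ^ 2) ^ 2 = 1 := by rw [Real.sq_sqrt hs]; ring
  set b := √(1 - (3 * ε) ^ 2)
  have hb0 : 0 ≤ b := Real.sqrt_nonneg _
  have h0 : (0 : ℝ) ^ 2 + 1 ^ 2 = 1 := by norm_num
  set i : Fin k := ⟨0, hk⟩
  have hd : √((3 * ε - 0) ^ 2 + (b - 1) ^ 2) ≤ 6 * ε := by
    have hb1 : b ≤ 1 := by nlinarith
    -- Since `0 ≤ b ≤ 1`, `1 - b ≤ 1 - b² = 9ε² ≤ 3ε`.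
    have hb2 : 1 - b ≤ 3 * ε := by nlinarith
    refine Real.sqrt_le_iff.2 ⟨by positivity, ?_⟩
    nlinarith
  have hlow := hA.norm_finalState_sub_ge (wireRotation i (3 * ε) b hb) (wireRotation i 0 1 h0) 1
    (by rw [sqrtFidelity_wireRotation, sqrtFidelity_wireRotation, abs_zero,
          abs_of_pos (by positivity)]
        linarith)
  have hup := A.norm_finalState_sub_le (wireRotation i (3 * ε) b hb) (wireRotation i 0 1 h0) 1
    (fun q v => q.norm_op_wireRotation_sub_le 1 i _ _ _ _ hb h0 v) (Real.sqrt_nonneg _)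
  have hQ : (A.queryComplexity : ℝ) * √((3 * ε - 0) ^ 2 + (b - 1) ^ 2) ≤
      A.queryComplexity * (6 * ε) := by gcongr
  rw [div_le_iff₀ hε]
  linarith
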